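/- Let $r\ge 1$ and $n\ge 0$ be integers, let $\star\in\{\top,\mathsf H\}$ (transpose or conjugate transpose), and let $A_k,B_k,C_k,D_k\in\mathbb C^{n\times n}$ for $k=1,\dots,r$. Call the periodic system $$A_kX_kB_k-C_kX_{k+1}D_k=E_k\quad(k=1,\dots,r-1),\qquad A_rX_rB_r-C_rX_1^\star D_r=E_r$$ in the unknowns $X_1,\dots,X_r\in\mathbb C^{n\times n}$ nonsingular if it has exactly one solution for every right-hand side $E_1,\dots,E_r\in\mathbb C^{n\times n}$. For matrices $M_k,N_k\in\mathbb C^{n\times n}$, $k=1,\dots,p$ (the $N_k$ need not be invertible), a formal periodic Schur form of the formal matrix product $N_p^{-1}M_p\cdots N_1^{-1}M_1$ consists of unitary matrices $Q_k,Z_k$ such that $T_k=Q_k^{\mathsf H}M_kZ_k$ and $R_k=Q_k^{\mathsf H}N_kZ_{k+1}$ are upper triangular for $k=1,\dots,p$, where $Z_{p+1}=Z_1$. The formal product is singular if $\prod_k(T_k)_{ii}=\prod_k(R_k)_{ii}=0$ for some $i$, and regular otherwise. If it is regular, its eigenvalues are $\lambda_i=\prod_k(T_k)_{ii}/\prod_k(R_k)_{ii}\in\mathbb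 C\cup\{\infty\}$, $i=1,\dots,n$, with $a/0=\infty$ for $a\ne0$; its spectrum $\Lambda$ is the set of the $\lambda_i$, and the multiplicity of $\lambda$ is the number of $i$ with $\lambda_i=\lambda$. A set $\mathcal S\subseteq\mathbb C\cup\{\infty\}$ is reciprocal free if $\lambda\ne\mu^{-1}$ for all $\lambda,\mu\in\mathcal S$, and $\mathsf H$-reciprocal free if $\lambda\ne(\overline\mu)^{-1}$ for all $\lambda,\mu\in\mathcal S$ (in both cases $\lambda=\mu$ is allowed, and $0^{-1}=\infty$, $\infty^{-1}=0$, $\overline\infty=\infty$). Theorem. The formal matrix product $$\Pi=D_r^{-\star}B_r^\star D_{r-1}^{-\star}B_{r-1}^\star\cdots D_1^{-\star}B_1^\star\,C_r^{-1}A_rC_{r-1}^{-1}A_{r-1}\cdots C_1^{-1}A_1$$ has a formal periodic Schur form, and, whichever such form is used to define the notions above, the periodic system is nonsingular if and only if $\Pi$ is regular and - if $\star=\mathsf H$, then $\Lambda(\Pi)$ is $\mathsf H$-reciprocal free; - if $\star=\top$, then $\Lambda(\Pi)\setminus\{-1\}$ is reciprocal free and the multiplicity of $-1$ as an eigenvalue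 of $\Pi$ is at most $1$. -/

import Mathlib

open scoped Matrix

noncomputable section

namespace PeriodicSylvester

/-- The two meanings of `⋆`: transpose, or conjugate transpose. -/
inductive StarOp
  | transpose
  | conjTranspose

/-- The matrix `M^⋆`. -/
def StarOp.app {n : ℕ} (s : StarOp) (M : Matrix (Fin n) (Fin n) ℂ) : Matrix (Fin n) (Fin n) ℂ :=
  match s with
  | .transpose => Mᵀ
  | .conjTranspose => Mᴴ

/-- The cyclic successor on `Fin p`: the last index is followed by the first one. -/
def cyclicSucc {p : ℕ} (k : Fin p) : Fin p := ⟨(k.val + 1) % p, Nat.mod_lt _ k.pos⟩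

/-- `X` solves `A_k X_k B_k - C_k X_{k+1} D_k = E_k` for every index `k` but the last, and
`A_r X_r B_r - C_r X_1^⋆ D_r = E_r` for the last one. -/
def IsSolution {r n : ℕ} (s : StarOp) (A B C D E X : Fin r → Matrix (Fin n) (Fin n) ℂ) : Prop :=
  (∀ k : Fin r, k.val + 1 < r →
    A k * X k * B k - C k * X (cyclicSucc k) * D k = E k) ∧
  (∀ k : Fin r, k.val + 1 = r →
    A k * X k * B k - C k * s.app (X (cyclicSucc k)) * D k = E k)

/-- The system has exactly one solution for each right-hand side. -/
def IsNonsingularSystem {r n : ℕ} (s : StarOp)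
    (A B C D : Fin r → Matrix (Fin n) (Fin n) ℂ) : Prop :=
  ∀ E : Fin r → Matrix (Fin n) (Fin n) ℂ,
    ∃! X : Fin r → Matrix (Fin n) (Fin n) ℂ, IsSolution s A B C D E X

/-- The formal matrix product `N_p⁻¹ M_p N_{p-1}⁻¹ M_{p-1} ⋯ N_1⁻¹ M_1`, that is the sequences of
its factors; the `N_k` need not be invertible. -/
structure FormalProduct (p n : ℕ) where
  M : Fin p → Matrix (Fin n) (Fin n) ℂ
  N : Fin p → Matrix (Fin n) (Fin n) ℂ

/-- The formal product
`D_r^{-⋆} B_r^⋆ ⋯ D_1^{-⋆} B_1^⋆ C_r⁻¹ A_r ⋯ C_1⁻¹ A_1`, with `2 r` pairs of factors. -/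
def starProduct {r n : ℕ} (s : StarOp) (A B C D : Fin r → Matrix (Fin n) (Fin n) ℂ) :
    FormalProduct (r + r) n where
  M := Fin.append A (fun k => s.app (B k))
  N := Fin.append C (fun k => s.app (D k))

/-- A formal periodic Schur form: unitary `Q_k`, `Z_k` such that `T_k = Q_kᴴ M_k Z_k` and
`R_k = Q_kᴴ N_k Z_{k+1}` are upper triangular for all `k`, where `Z_{p+1} = Z_1`. -/
structure PeriodicSchurForm {p n : ℕ} (P : FormalProduct p n) where
  Q : Fin p → Matrix (Fin n) (Fin n) ℂ
  Z : Fin p → Matrix (Fin n) (Fin n) ℂ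
  T : Fin p → Matrix (Fin n) (Fin n) ℂ
  R : Fin p → Matrix (Fin n) (Fin n) ℂ
  Q_unitary : ∀ k, Q k ∈ Matrix.unitaryGroup (Fin n) ℂ
  Z_unitary : ∀ k, Z k ∈ Matrix.unitaryGroup (Fin n) ℂ
  T_eq : ∀ k, (Q k)ᴴ * P.M k * Z k = T k
  R_eq : ∀ k, (Q k)ᴴ * P.N k * Z (cyclicSucc k) = R k
  T_upper : ∀ k, ∀ i j, j < i → T k i j = 0
  R_upper : ∀ k, ∀ i j, j < i → R k i j = 0

namespace PeriodicSchurForm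

variable {p n : ℕ} {P : FormalProduct p n}

/-- `P` is regular: for no `i` are `∏ₖ (T_k)_{ii}` and `∏ₖ (R_k)_{ii}` both zero. -/
def IsRegular (S : PeriodicSchurForm P) : Prop :=
  ∀ i, ¬ ((∏ k, S.T k i i) = 0 ∧ (∏ k, S.R k i i) = 0)

open Classical in
/-- The `i`-th eigenvalue `∏ₖ (T_k)_{ii} / ∏ₖ (R_k)_{ii}` in `ℂ ∪ {∞}` of a regular formal product,
with `a / 0 = ∞` for `a ≠ 0`. (It carries no meaning if the formal product is singular.) -/
def eigenvalue (S : PeriodicSchurForm P) (i : Fin n) : OnePoint ℂ :=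
  if (∏ k, S.R k i i) = 0 then OnePoint.infty
  else (((∏ k, S.T k i i) / (∏ k, S.R k i i) : ℂ) : OnePoint ℂ)

/-- The spectrum, a subset of `ℂ ∪ {∞}`. -/
def spectrum (S : PeriodicSchurForm P) : Set (OnePoint ℂ) := Set.range S.eigenvalue

/-- The multiplicity of `z` as an eigenvalue: the number of `i` with `λ_i = z`. -/
def multiplicity (S : PeriodicSchurForm P) (z : OnePoint ℂ) : ℕ :=
  {i : Fin n | S.eigenvalue i = z}.ncard

end PeriodicSchurForm

open Classical in
/-- The reciprocal on `ℂ ∪ {∞}`, with `0⁻¹ = ∞` and `∞⁻¹ = 0`. -/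
def recip (z : OnePoint ℂ) : OnePoint ℂ :=
  z.elim ((0 : ℂ) : OnePoint ℂ)
    (fun w => if w = 0 then OnePoint.infty else ((w⁻¹ : ℂ) : OnePoint ℂ))

/-- Complex conjugation on `ℂ ∪ {∞}`, fixing `∞`. -/
def conjugate (z : OnePoint ℂ) : OnePoint ℂ := OnePoint.map (starRingEnd ℂ) z

/-- `λ ≠ μ⁻¹` for all `λ`, `μ` in the set (including `λ = μ`). -/
def IsReciprocalFree (L : Set (OnePoint ℂ)) : Prop :=
  ∀ z ∈ L, ∀ w ∈ L, z ≠ recip w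

/-- `λ ≠ (conj μ)⁻¹` for all `λ`, `μ` in the set (including `λ = μ`). -/
def IsHReciprocalFree (L : Set (OnePoint ℂ)) : Prop :=
  ∀ z ∈ L, ∀ w ∈ L, z ≠ recip (conjugate w)

end PeriodicSylvester

end

/-! The periodic Schur form comes from deflation: a cyclic family of invariant lines
(`hasInvariantLines`) supplies the first columns of all the unitary factors, and induction on `n`
does the rest.

For the criterion, put `X_{k+r} = X_k^⋆`. The system becomes a cyclic one of length `2r`, `M_k X_k
M_{k+r}^⋆ - N_k X_{k+1} N_{k+r}^⋆ = E_k`, on a real subspace of `⋆`-invariant sequences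
(`isNonsingularSystem_iff`). It is square over `ℝ`, so nonsingularity means trivial kernel, and this
survives the passage to the Schur form (`PeriodicSchurForm.hasTrivialKernel_iff`). Triangular
coefficients allow back substitution along decreasing `i + j`, which leaves one scalar cyclic system
per entry (`hasTrivialKernel_iff_entries`).

A scalar cyclic system `α_k y_k = β_k y_{k+1}` has only the zero solution iff `∏ α ≠ ∏ β`
(`cyclicMap_injective_iff`). With `t_i = ∏ (T_k)_{ii}` and `ρ_i = ∏ (R_k)_{ii}` this reads `t_i t_j
≠ ρ_i ρ_j`, with a conjugate on the `j` factors if `⋆ = H`: no eigenvalue is the (conjugate)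
reciprocal of another. Diagonal entries carry the extra constraint of `⋆`-invariance. For `H` it
merely selects a real form and changes nothing. For the transpose it folds the cycle to length `r`,
and `t_i² ≠ ρ_i²` weakens to `t_i ≠ ρ_i`; this is why a single eigenvalue `-1` is harmless. -/

noncomputable section

namespace PeriodicSylvester

/-! ### Existence of the periodic Schur form -/

/-- Lines spanned by `v k` and `w k` such that `M k` maps `v k`, and `N k` maps `v (k + 1)`, into the
line of `w k`, the indices being cyclic. -/
def HasInvariantLines {q n : ℕ} (M N : Fin (q + 1) → Matrix (Fin n) (Fin n) ℂ) : Prop :=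
  ∃ v w : Fin (q + 1) → Fin n → ℂ, (∀ k, v k ≠ 0) ∧ (∀ k, w k ≠ 0) ∧
    (∀ k, ∃ a : ℂ, M k *ᵥ v k = a • w k) ∧ ∀ k, ∃ b : ℂ, N k *ᵥ v (k + 1) = b • w k

theorem exists_ne_zero_mulVec_eq_smul {n : ℕ} (N : Matrix (Fin n) (Fin n) ℂ) {w : Fin n → ℂ}
    (hw : w ≠ 0) : ∃ v : Fin n → ℂ, v ≠ 0 ∧ ∃ b : ℂ, N *ᵥ v = b • w := by
  by_cases h : N.det = 0
  · obtain ⟨v, hv, h0⟩ := Matrix.exists_mulVec_eq_zero_iff.2 h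
    exact ⟨v, hv, 0, by simp [h0]⟩
  · have e : N *ᵥ (N⁻¹ *ᵥ w) = w := by
      rw [Matrix.mulVec_mulVec, Matrix.mul_nonsing_inv _ (Ne.isUnit h), Matrix.one_mulVec]
    refine ⟨N⁻¹ *ᵥ w, fun h0 => hw ?_, 1, by rw [e, one_smul]⟩
    rw [← e, h0, Matrix.mulVec_zero]

theorem exists_ne_zero_eq_smul {n : ℕ} {v : Fin n → ℂ} (hv : v ≠ 0) (u : Fin n → ℂ) :
    ∃ w : Fin n → ℂ, w ≠ 0 ∧ ∃ a : ℂ, u = a • w := by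
  by_cases h : u = 0
  · exact ⟨v, hv, 0, by simp [h]⟩
  · exact ⟨u, h, 1, by simp⟩

/-- Going around the cycle from a kernel vector of the last `N`, each next line can always be
chosen. Closing the cycle costs nothing, because the last `N` kills the starting vector. -/
theorem hasInvariantLines_of_det_last {q n : ℕ} {M N : Fin (q + 1) → Matrix (Fin n) (Fin n) ℂ}
    (h : (N (Fin.last q)).det = 0) : HasInvariantLines M N := by
  obtain ⟨v₀, hv₀, h0⟩ := Matrix.exists_mulVec_eq_zero_iff.2 h
  have step : ∀ (k : Fin (q + 1)) (v : {v : Fin n → ℂ // v ≠ 0}),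
      ∃ v' : {v : Fin n → ℂ // v ≠ 0}, ∃ w : Fin n → ℂ, w ≠ 0 ∧
        (∃ a : ℂ, M k *ᵥ v = a • w) ∧ ∃ b : ℂ, N k *ᵥ v' = b • w := by
    rintro k ⟨v, hv⟩
    obtain ⟨w, hw, ha⟩ := exists_ne_zero_eq_smul hv (M k *ᵥ v)
    obtain ⟨v', hv', hb⟩ := exists_ne_zero_mulVec_eq_smul (N k) hw
    exact ⟨⟨v', hv'⟩, w, hw, ha, hb⟩
  choose g hg using step
  -- Only `u 0, …, u q` matter, so the wrap-around of `Fin.ofNat` is never felt.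
  let u : ℕ → {v : Fin n → ℂ // v ≠ 0} :=
    fun m => Nat.rec ⟨v₀, hv₀⟩ (fun k x => g (Fin.ofNat (q + 1) k) x) m
  have key : ∀ k : Fin (q + 1), ∃ w : Fin n → ℂ, w ≠ 0 ∧
      (∃ a : ℂ, M k *ᵥ (u k.val).1 = a • w) ∧
      ∃ b : ℂ, N k *ᵥ (u (k + 1).val).1 = b • w := by
    intro k
    induction k using Fin.lastCases with
    | last =>
      obtain ⟨w, hw, ha⟩ := exists_ne_zero_eq_smul hv₀ (M (Fin.last q) *ᵥ (u q).1)
      refine ⟨w, hw, ha, 0, ?_⟩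
      rw [Fin.last_add_one, zero_smul]
      exact h0
    | cast j =>
      have e : Fin.ofNat (q + 1) j.val = j.castSucc := by
        ext; simp
      have := hg j.castSucc (u j.val)
      rw [Fin.coeSucc_eq_succ]
      change ∃ w : Fin n → ℂ, w ≠ 0 ∧ _ ∧
        ∃ b : ℂ, _ *ᵥ (g (Fin.ofNat (q + 1) j.val) (u j.val)).1 = b • w
      rw [e]
      exact this
  choose w hw ha hb using key
  exact ⟨fun k => (u k.val).1, w, fun k => (u k.val).2, hw, ha, hb⟩

theorem HasInvariantLines.of_rotate {q n : ℕ} {M N : Fin (q + 1) → Matrix (Fin n) (Fin n) ℂ}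
    (c : Fin (q + 1)) (h : HasInvariantLines (fun k => M (k + c)) (fun k => N (k + c))) :
    HasInvariantLines M N := by
  obtain ⟨v, w, hv, hw, ha, hb⟩ := h
  refine ⟨fun k => v (k - c), fun k => w (k - c), fun k => hv _, fun k => hw _, fun k => ?_,
    fun k => ?_⟩
  · simpa using ha (k - c)
  · have := hb (k - c)
    simp only [sub_add_cancel, sub_add_eq_add_sub] at this
    exact this

/-- Traversing the cycle backwards exchanges the roles of `M` and `N`, so a singular `M k` reduces
to a singular `N k`. -/
theorem HasInvariantLines.of_reverse {q n : ℕ} {M N : Fin (q + 1) → Matrix (Fin n) (Fin n) ℂ}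
    (h : HasInvariantLines (fun k => N (-k - 1)) (fun k => M (-k - 1))) :
    HasInvariantLines M N := by
  obtain ⟨v, w, hv, hw, ha, hb⟩ := h
  refine ⟨fun k => v (-k), fun k => w (-k - 1), fun k => hv _, fun k => hw _, fun k => ?_,
    fun k => ?_⟩
  · simpa using hb (-k - 1)
  · have := ha (-k - 1)
    have e : -(-k - 1) - 1 = k := by abel
    have e' : -(k + 1) = -k - 1 := by abel
    simp only [e] at this
    simpa only [e'] using this

theorem hasInvariantLines_of_det {q n : ℕ} {M N : Fin (q + 1) → Matrix (Fin n) (Fin n) ℂ}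
    {k : Fin (q + 1)} (h : (N k).det = 0) : HasInvariantLines M N :=
  .of_rotate (k - Fin.last q) (hasInvariantLines_of_det_last (by simpa using h))

/-- If all factors are invertible, the formal product is a genuine matrix; its partial products
carry one of its eigenvectors around the cycle. Otherwise a singular factor gives the lines
directly. -/
theorem hasInvariantLines {q n : ℕ} [NeZero n] (M N : Fin (q + 1) → Matrix (Fin n) (Fin n) ℂ) :
    HasInvariantLines M N := by
  by_cases hN : ∃ k, (N k).det = 0
  · exact hasInvariantLines_of_det hN.choose_spec
  by_cases hM : ∃ k, (M k).det = 0
  · obtain ⟨k, hk⟩ := hM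
    refine .of_reverse (hasInvariantLines_of_det (k := -k - 1) ?_)
    have e : -(-k - 1) - 1 = k := by abel
    rwa [e]
  push Not at hN hM
  let P : ℕ → Matrix (Fin n) (Fin n) ℂ := fun m =>
    Nat.rec 1 (fun k x => (N (Fin.ofNat (q + 1) k))⁻¹ * M (Fin.ofNat (q + 1) k) * x) m
  have hP : ∀ m, P (m + 1) = (N (Fin.ofNat (q + 1) m))⁻¹ * M (Fin.ofNat (q + 1) m) * P m :=
    fun m => rfl
  have hdet : ∀ m, (P m).det ≠ 0 := by
    intro m
    induction m with
    | zero => simp [P]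
    | succ m ih =>
      rw [hP, Matrix.det_mul, Matrix.det_mul, Matrix.det_nonsing_inv]
      have := hN (Fin.ofNat (q + 1) m)
      exact mul_ne_zero (mul_ne_zero (by simpa using this) (hM _)) ih
  have hstep : ∀ m, N (Fin.ofNat (q + 1) m) * P (m + 1) = M (Fin.ofNat (q + 1) m) * P m := by
    intro m
    rw [hP, Matrix.mul_assoc, Matrix.mul_nonsing_inv_cancel_left _ _ (Ne.isUnit (hN _))]
  have hinj : ∀ {B : Matrix (Fin n) (Fin n) ℂ} {x : Fin n → ℂ}, B.det ≠ 0 → x ≠ 0 → B *ᵥ x ≠ 0 :=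
    fun hB hx h0 => hB (Matrix.exists_mulVec_eq_zero_iff.1 ⟨_, hx, h0⟩)
  obtain ⟨l, hl⟩ := Module.End.exists_eigenvalue (Matrix.toLin' (P (q + 1)))
  obtain ⟨x, hx⟩ := hl.exists_hasEigenvector
  have hx0 : x ≠ 0 := hx.2
  have hxe : P (q + 1) *ᵥ x = l • x := by simpa using hx.apply_eq_smul
  have hl0 : l ≠ 0 := by
    rintro rfl
    exact hinj (hdet (q + 1)) hx0 (by simpa using hxe)
  refine ⟨fun k => P k.val *ᵥ x, fun k => M k *ᵥ (P k.val *ᵥ x), fun k => hinj (hdet _) hx0,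
    fun k => hinj (hM _) (hinj (hdet _) hx0), fun k => ⟨1, by simp⟩, fun k => ?_⟩
  induction k using Fin.lastCases with
  | last =>
    -- The full product maps `x` to `l • x`, whereas the cycle must return to `x` itself; `l⁻¹`
    -- makes up for it.
    refine ⟨l⁻¹, ?_⟩
    have e : Fin.ofNat (q + 1) q = Fin.last q := by ext; simp
    have := hstep q
    rw [e] at this
    simp only [Fin.last_add_one, Fin.val_last, Matrix.mulVec_mulVec]
    rw [← this, ← Matrix.mulVec_mulVec x (N _) (P (q + 1)), hxe, Matrix.mulVec_smul, smul_smul,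
      inv_mul_cancel₀ hl0, one_smul]
    simp [P]
  | cast j =>
    refine ⟨1, ?_⟩
    have e : Fin.ofNat (q + 1) j.val = j.castSucc := by
      ext; simp
    have := hstep j.val
    rw [e] at this
    simp only [Fin.coeSucc_eq_succ, one_smul, Matrix.mulVec_mulVec, Fin.val_succ,
      Fin.val_castSucc, this]

theorem exists_unitary_col_eq_smul {n : ℕ} {v : Fin (n + 1) → ℂ} (hv : v ≠ 0) :
    ∃ U ∈ Matrix.unitaryGroup (Fin (n + 1)) ℂ, ∃ c : ℂ, c ≠ 0 ∧ U.col 0 = c • v := by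
  have hv' : WithLp.toLp 2 v ≠ 0 := by simpa using hv
  let c : ℂ := (‖WithLp.toLp 2 v‖ : ℂ)⁻¹
  have hc : c ≠ 0 := by simpa [c] using hv
  have hn : ‖c • WithLp.toLp 2 v‖ = 1 := by
    rw [norm_smul]; simp only [c, norm_inv, Complex.norm_real, norm_norm]
    exact inv_mul_cancel₀ (norm_ne_zero_iff.2 hv')
  have ho : Orthonormal ℂ (Set.domRestrict {(0 : Fin (n + 1))}
      (fun _ => c • WithLp.toLp 2 v : Fin (n + 1) → EuclideanSpace ℂ (Fin (n + 1)))) := by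
    refine ⟨fun i => hn, fun i j hij => (hij (Subsingleton.elim _ _)).elim⟩
  obtain ⟨b, hb⟩ := ho.exists_orthonormalBasis_extension_of_card_eq (by simp)
  refine ⟨(EuclideanSpace.basisFun (Fin (n + 1)) ℂ).toBasis.toMatrix b,
    OrthonormalBasis.toMatrix_orthonormalBasis_mem_unitary _ _, c, hc, ?_⟩
  ext i
  simp [Module.Basis.toMatrix_apply, hb 0 rfl]

/-- The block diagonal matrix with diagonal blocks `1` and `Z`. -/
def bordered {n : ℕ} (Z : Matrix (Fin n) (Fin n) ℂ) : Matrix (Fin (n + 1)) (Fin (n + 1)) ℂ :=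
  Matrix.of (Fin.cons (Fin.cons 1 0) fun i => Fin.cons 0 (Z i))

@[simp] theorem bordered_zero_zero {n : ℕ} (Z : Matrix (Fin n) (Fin n) ℂ) :
    bordered Z 0 0 = 1 := rfl

@[simp] theorem bordered_zero_succ {n : ℕ} (Z : Matrix (Fin n) (Fin n) ℂ) (j : Fin n) :
    bordered Z 0 j.succ = 0 := rfl

@[simp] theorem bordered_succ_zero {n : ℕ} (Z : Matrix (Fin n) (Fin n) ℂ) (i : Fin n) :
    bordered Z i.succ 0 = 0 := rfl

@[simp] theorem bordered_succ_succ {n : ℕ} (Z : Matrix (Fin n) (Fin n) ℂ) (i j : Fin n) :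
    bordered Z i.succ j.succ = Z i j := rfl

theorem bordered_mem_unitaryGroup {n : ℕ} {Z : Matrix (Fin n) (Fin n) ℂ}
    (hZ : Z ∈ Matrix.unitaryGroup (Fin n) ℂ) :
    bordered Z ∈ Matrix.unitaryGroup (Fin (n + 1)) ℂ := by
  rw [Matrix.mem_unitaryGroup_iff] at hZ ⊢
  have h := fun i j => congrFun (congrFun hZ i) j
  simp only [Matrix.mul_apply, Matrix.star_apply, Matrix.one_apply] at h
  ext i j
  refine Fin.cases ?_ (fun i => ?_) i <;> refine Fin.cases ?_ (fun j => ?_) j <;>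
    simp [Matrix.mul_apply, Fin.sum_univ_succ, Matrix.one_apply, (Fin.succ_ne_zero _).symm]
  simpa using h i j

theorem bordered_sandwich_upper {n : ℕ} {Q Z : Matrix (Fin n) (Fin n) ℂ}
    {X : Matrix (Fin (n + 1)) (Fin (n + 1)) ℂ} (hX : ∀ i : Fin n, X i.succ 0 = 0)
    (h : ∀ i j, j < i → (Qᴴ * X.submatrix Fin.succ Fin.succ * Z) i j = 0) (i j : Fin (n + 1))
    (hij : j < i) : ((bordered Q)ᴴ * X * bordered Z) i j = 0 := by
  induction i using Fin.cases with
  | zero => simp at hij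
  | succ i =>
    induction j using Fin.cases with
    | zero => simp [Matrix.mul_apply, Fin.sum_univ_succ, hX]
    | succ j =>
      have := h i j (by simpa using hij)
      simpa [Matrix.mul_apply, Fin.sum_univ_succ] using this

/-- The first column of `Wᴴ * M * U` is a multiple of `Wᴴ *ᵥ w`, hence of the first column of `Wᴴ *
W = 1`. -/
theorem conjTranspose_mul_mul_succ_zero {n : ℕ} {M W U : Matrix (Fin (n + 1)) (Fin (n + 1)) ℂ}
    (hW : W ∈ Matrix.unitaryGroup (Fin (n + 1)) ℂ) {v w : Fin (n + 1) → ℂ} {a c d : ℂ}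
    (hd : d ≠ 0) (hU : U.col 0 = c • v) (hw : W.col 0 = d • w) (hM : M *ᵥ v = a • w) (i : Fin n) :
    (Wᴴ * M * U) i.succ 0 = 0 := by
  have e : (Wᴴ * M * U).col 0 = (c * a * d⁻¹) • (Wᴴ * W).col 0 := by
    have hcol : ∀ (X Y : Matrix (Fin (n + 1)) (Fin (n + 1)) ℂ), (X * Y).col 0 = X *ᵥ Y.col 0 :=
      fun X Y => rfl
    rw [hcol, hcol, hU, hw, Matrix.mulVec_smul, ← Matrix.mulVec_mulVec, hM]
    simp only [Matrix.mulVec_smul, smul_smul]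
    rw [mul_assoc, mul_assoc, inv_mul_cancel₀ hd, mul_one]
  have := congrFun e i.succ
  rw [← Matrix.star_eq_conjTranspose W, Matrix.mem_unitaryGroup_iff'.1 hW] at this
  simpa [Matrix.one_apply, Matrix.star_eq_conjTranspose] using this

theorem exists_unitary_upperTriangular (q n : ℕ) (M N : Fin (q + 1) → Matrix (Fin n) (Fin n) ℂ) :
    ∃ Q Z : Fin (q + 1) → Matrix (Fin n) (Fin n) ℂ,
      (∀ k, Q k ∈ Matrix.unitaryGroup (Fin n) ℂ) ∧ (∀ k, Z k ∈ Matrix.unitaryGroup (Fin n) ℂ) ∧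
      (∀ k i j, j < i → ((Q k)ᴴ * M k * Z k) i j = 0) ∧
      ∀ k i j, j < i → ((Q k)ᴴ * N k * Z (k + 1)) i j = 0 := by
  induction n with
  | zero => exact ⟨1, 1, fun _ => one_mem _, fun _ => one_mem _, fun _ i => i.elim0,
      fun _ i => i.elim0⟩
  | succ n ih =>
    obtain ⟨v, w, hv, hw, ha, hb⟩ := hasInvariantLines M N
    choose a ha using ha
    choose b hb using hb
    choose U hU c hc hUv using fun k => exists_unitary_col_eq_smul (hv k)
    choose W hW d hd hWw using fun k => exists_unitary_col_eq_smul (hw k)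
    obtain ⟨Q, Z, hQ, hZ, hT, hR⟩ := ih
      (fun k => ((W k)ᴴ * M k * U k).submatrix Fin.succ Fin.succ)
      (fun k => ((W k)ᴴ * N k * U (k + 1)).submatrix Fin.succ Fin.succ)
    refine ⟨fun k => W k * bordered (Q k), fun k => U k * bordered (Z k),
      fun k => mul_mem (hW k) (bordered_mem_unitaryGroup (hQ k)),
      fun k => mul_mem (hU k) (bordered_mem_unitaryGroup (hZ k)), fun k i j hij => ?_,
      fun k i j hij => ?_⟩
    · have := bordered_sandwich_upper
        (conjTranspose_mul_mul_succ_zero (hW k) (hd k) (hUv k) (hWw k) (ha k)) (hT k) i j hij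
      simpa only [Matrix.conjTranspose_mul, Matrix.mul_assoc] using this
    · have := bordered_sandwich_upper
        (conjTranspose_mul_mul_succ_zero (hW k) (hd k) (hUv (k + 1)) (hWw k) (hb k)) (hR k) i j hij
      simpa only [Matrix.conjTranspose_mul, Matrix.mul_assoc] using this

theorem cyclicSucc_eq_add_one {p : ℕ} [NeZero p] (k : Fin p) : cyclicSucc k = k + 1 := by
  ext; simp [cyclicSucc, Fin.val_add]

theorem nonempty_periodicSchurForm {p n : ℕ} (P : FormalProduct p n) :
    Nonempty (PeriodicSchurForm P) := by
  cases p with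
  | zero => exact ⟨⟨1, 1, 1, 1, fun k => k.elim0, fun k => k.elim0, fun k => k.elim0,
      fun k => k.elim0, fun k => k.elim0, fun k => k.elim0⟩⟩
  | succ q =>
    obtain ⟨Q, Z, hQ, hZ, hT, hR⟩ := exists_unitary_upperTriangular q n P.M P.N
    exact ⟨⟨Q, Z, _, _, hQ, hZ, fun _ => rfl, fun _ => rfl, hT,
      fun k => by simpa only [cyclicSucc_eq_add_one] using hR k⟩⟩

/-! ### The `⋆` operation and cyclic systems of `⋆`-invariant sequences -/

/-- The involution of `ℂ` by which `M^⋆` differs from the transpose of `M`. -/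
def StarOp.conj : StarOp → ℂ →+* ℂ
  | .transpose => RingHom.id ℂ
  | .conjTranspose => starRingEnd ℂ

namespace StarOp

variable {n : ℕ} (s : StarOp)

@[simp] theorem conj_conj (z : ℂ) : s.conj (s.conj z) = z := by
  cases s <;> simp [conj]

@[simp] theorem conj_ofReal (x : ℝ) : s.conj x = x := by
  cases s <;> simp [conj]

@[simp] theorem app_apply (M : Matrix (Fin n) (Fin n) ℂ) (i j : Fin n) :
    s.app M i j = s.conj (M j i) := by
  cases s <;> rfl

@[simp] theorem app_app (M : Matrix (Fin n) (Fin n) ℂ) : s.app (s.app M) = M := by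
  ext; simp

@[simp] theorem app_zero : s.app (0 : Matrix (Fin n) (Fin n) ℂ) = 0 := by
  ext; simp

@[simp] theorem app_one : s.app (1 : Matrix (Fin n) (Fin n) ℂ) = 1 := by
  ext i j
  simp [Matrix.one_apply, eq_comm, apply_ite]

theorem app_add (M N : Matrix (Fin n) (Fin n) ℂ) : s.app (M + N) = s.app M + s.app N := by
  ext; simp

theorem app_sub (M N : Matrix (Fin n) (Fin n) ℂ) : s.app (M - N) = s.app M - s.app N := by
  ext; simp

theorem app_smul (x : ℝ) (M : Matrix (Fin n) (Fin n) ℂ) : s.app (x • M) = x • s.app M := by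
  ext; simp

theorem app_mul (M N : Matrix (Fin n) (Fin n) ℂ) : s.app (M * N) = s.app N * s.app M := by
  ext; simp [Matrix.mul_apply, mul_comm]

theorem app_mul_app {M N : Matrix (Fin n) (Fin n) ℂ} (h : M * N = 1) :
    s.app N * s.app M = 1 := by
  rw [← app_mul, h, app_one]

end StarOp

section CyclicSystem

variable {m n : ℕ} (s : StarOp) (c : Fin m)

/-- The real subspace of the cyclic sequences with `X (k + c) = (X k)^⋆`. -/
def starInvariant (n : ℕ) : Submodule ℝ (Fin m → Matrix (Fin n) (Fin n) ℂ) where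
  carrier := {X | ∀ k, X (k + c) = s.app (X k)}
  add_mem' hX hY k := by simp [hX k, hY k, StarOp.app_add]
  zero_mem' k := by simp
  smul_mem' x X hX k := by simp [hX k, StarOp.app_smul]

variable [NeZero m]

/-- The left-hand side `M_k X_k (M_{k+c})^⋆ - N_k X_{k+1} (N_{k+c})^⋆` of the cyclic system. -/
def sylvesterMap (M N : Fin m → Matrix (Fin n) (Fin n) ℂ) :
    (Fin m → Matrix (Fin n) (Fin n) ℂ) →ₗ[ℝ] (Fin m → Matrix (Fin n) (Fin n) ℂ) where
  toFun X k := M k * X k * s.app (M (k + c)) - N k * X (k + 1) * s.app (N (k + c))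
  map_add' X Y := by
    ext1 k
    simp only [Pi.add_apply, Matrix.mul_add, Matrix.add_mul]
    abel
  map_smul' x X := by
    ext1 k
    simp [smul_sub]

theorem sylvesterMap_apply (M N X : Fin m → Matrix (Fin n) (Fin n) ℂ) (k : Fin m) :
    sylvesterMap s c M N X k =
      M k * X k * s.app (M (k + c)) - N k * X (k + 1) * s.app (N (k + c)) := rfl

variable {s c}

theorem sylvesterMap_mem (hc : c + c = 0) (M N : Fin m → Matrix (Fin n) (Fin n) ℂ)
    {X : Fin m → Matrix (Fin n) (Fin n) ℂ} (hX : X ∈ starInvariant s c n) :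
    sylvesterMap s c M N X ∈ starInvariant s c n := by
  intro k
  have h2 : k + c + c = k := by rw [add_assoc, hc, add_zero]
  have h1 : X (k + c + 1) = s.app (X (k + 1)) := by rw [add_right_comm]; exact hX _
  simp only [sylvesterMap_apply, h2, h1, hX k, StarOp.app_sub, StarOp.app_mul, StarOp.app_app,
    Matrix.mul_assoc]

variable (s c) in
/-- The homogeneous cyclic system has only the zero solution among the `⋆`-invariant sequences. -/
def HasTrivialKernel (M N : Fin m → Matrix (Fin n) (Fin n) ℂ) : Prop :=
  ∀ X ∈ starInvariant s c n, sylvesterMap s c M N X = 0 → X = 0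

/-- The map is an endomorphism of a finite-dimensional space. The scalars are real because `⋆ = H`
is only conjugate-linear. -/
theorem hasTrivialKernel_iff_surjOn (hc : c + c = 0) (M N : Fin m → Matrix (Fin n) (Fin n) ℂ) :
    HasTrivialKernel s c M N ↔
      ∀ E ∈ starInvariant s c n, ∃ X ∈ starInvariant s c n, sylvesterMap s c M N X = E := by
  let f : starInvariant s c n →ₗ[ℝ] starInvariant s c n :=
    (sylvesterMap s c M N).restrict fun X hX => sylvesterMap_mem hc M N hX
  have hf : Function.Injective f ↔ Function.Surjective f := LinearMap.injective_iff_surjective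
  have h1 : HasTrivialKernel s c M N ↔ Function.Injective f := by
    rw [injective_iff_map_eq_zero]
    constructor
    · rintro h ⟨X, hX⟩ h0
      exact Subtype.ext (h X hX (congrArg Subtype.val h0))
    · intro h X hX h0
      exact congrArg Subtype.val (h ⟨X, hX⟩ (Subtype.ext h0))
  rw [h1, hf]
  constructor
  · intro h E hE
    obtain ⟨X, hX⟩ := h ⟨E, hE⟩
    exact ⟨X, X.2, congrArg Subtype.val hX⟩
  · rintro h ⟨E, hE⟩
    obtain ⟨X, hX, e⟩ := h E hE
    exact ⟨⟨X, hX⟩, Subtype.ext e⟩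

/-- Substitute `X_k = V_k Y_k V_{k+c}^⋆` and multiply the equations by `U_k` and `U_{k+c}^⋆`. This
respects `⋆`-invariance because `c + c = 0`, and it is undone by `U'` and `V'`. -/
theorem HasTrivialKernel.of_equivalent (hc : c + c = 0)
    {M N U U' V V' : Fin m → Matrix (Fin n) (Fin n) ℂ} (hU : ∀ k, U' k * U k = 1)
    (hV : ∀ k, V' k * V k = 1) (h : HasTrivialKernel s c M N) :
    HasTrivialKernel s c (fun k => U k * M k * V k) (fun k => U k * N k * V (k + 1)) := by
  intro Y hY h0
  let X : Fin m → Matrix (Fin n) (Fin n) ℂ := fun k => V k * Y k * s.app (V (k + c))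
  have hX : X ∈ starInvariant s c n := by
    intro k
    have h2 : k + c + c = k := by rw [add_assoc, hc, add_zero]
    simp only [X, h2, hY k, StarOp.app_mul, StarOp.app_app, Matrix.mul_assoc]
  have hUX : ∀ k, U k * sylvesterMap s c M N X k * s.app (U (k + c)) = 0 := by
    intro k
    have := congrFun h0 k
    simp only [sylvesterMap_apply, StarOp.app_mul, add_right_comm k 1 c, X] at this ⊢
    simpa only [Matrix.mul_sub, Matrix.sub_mul, Matrix.mul_assoc, add_right_comm k c 1,
      Pi.zero_apply] using this
  have hX0 : X = 0 := by
    refine h X hX (funext fun k => ?_)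
    calc sylvesterMap s c M N X k
        = (U' k * U k) * sylvesterMap s c M N X k * (s.app (U (k + c)) * s.app (U' (k + c))) := by
          rw [hU, StarOp.app_mul_app s (hU _), Matrix.one_mul, Matrix.mul_one]
      _ = U' k * (U k * sylvesterMap s c M N X k * s.app (U (k + c))) * s.app (U' (k + c)) := by
          simp only [Matrix.mul_assoc]
      _ = 0 := by rw [hUX]; simp
  funext k
  calc Y k = (V' k * V k) * Y k * (s.app (V (k + c)) * s.app (V' (k + c))) := by
        rw [hV, StarOp.app_mul_app s (hV _), Matrix.one_mul, Matrix.mul_one]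
    _ = V' k * X k * s.app (V' (k + c)) := by simp only [X, Matrix.mul_assoc]
    _ = 0 := by rw [hX0]; simp

end CyclicSystem

/-! ### Unfolding the system to a cycle of length `r + r` -/

section Unfolding

variable {r n : ℕ} [NeZero r]

/-- Half a turn around the cycle of length `r + r`. -/
def halfTurn (r : ℕ) [NeZero r] : Fin (r + r) := Fin.natAdd r 0

instance neZero_add_self : NeZero (r + r) := ⟨by have := NeZero.ne r; omega⟩

theorem castAdd_add_halfTurn (k : Fin r) : Fin.castAdd r k + halfTurn r = Fin.natAdd r k := by
  ext
  simp only [halfTurn, Fin.val_add, Fin.val_castAdd, Fin.val_natAdd, Fin.val_zero, add_zero]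
  rw [Nat.mod_eq_of_lt (by omega)]; omega

theorem natAdd_add_halfTurn (k : Fin r) : Fin.natAdd r k + halfTurn r = Fin.castAdd r k := by
  ext
  simp only [halfTurn, Fin.val_add, Fin.val_castAdd, Fin.val_natAdd, Fin.val_zero, add_zero]
  rw [Nat.mod_eq_sub_mod (by omega), Nat.mod_eq_of_lt (by omega)]; omega

theorem halfTurn_add_halfTurn : halfTurn r + halfTurn r = 0 := by
  ext; simp [halfTurn, Fin.val_add]

theorem castAdd_add_one_of_lt {k : Fin r} (h : k.val + 1 < r) :
    Fin.castAdd r k + 1 = Fin.castAdd r (cyclicSucc k) := by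
  rw [← cyclicSucc_eq_add_one]
  ext
  simp only [cyclicSucc, Fin.val_castAdd]
  rw [Nat.mod_eq_of_lt h, Nat.mod_eq_of_lt (by omega)]

theorem castAdd_add_one_of_eq {k : Fin r} (h : k.val + 1 = r) :
    Fin.castAdd r k + 1 = Fin.natAdd r (cyclicSucc k) := by
  rw [← cyclicSucc_eq_add_one]
  ext
  simp only [cyclicSucc, Fin.val_castAdd, Fin.val_natAdd]
  have := NeZero.pos r
  rw [h, Nat.mod_self, Nat.mod_eq_of_lt (by omega), add_zero]

/-- The sequence `X_1, …, X_r, X_1^⋆, …, X_r^⋆`. -/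
def unfold (s : StarOp) (X : Fin r → Matrix (Fin n) (Fin n) ℂ) :
    Fin (r + r) → Matrix (Fin n) (Fin n) ℂ :=
  Fin.append X fun k => s.app (X k)

theorem unfold_mem (s : StarOp) (X : Fin r → Matrix (Fin n) (Fin n) ℂ) :
    unfold s X ∈ starInvariant s (halfTurn r) n := by
  intro k
  induction k using Fin.addCases with
  | left k => simp [castAdd_add_halfTurn, unfold, -Fin.natAdd_eq_addNat]
  | right k => simp [natAdd_add_halfTurn, unfold, -Fin.natAdd_eq_addNat]

theorem eq_of_mem_starInvariant {s : StarOp} {X Y : Fin (r + r) → Matrix (Fin n) (Fin n) ℂ}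
    (hX : X ∈ starInvariant s (halfTurn r) n) (hY : Y ∈ starInvariant s (halfTurn r) n)
    (h : ∀ k : Fin r, X (Fin.castAdd r k) = Y (Fin.castAdd r k)) : X = Y := by
  funext k
  induction k using Fin.addCases with
  | left k => exact h k
  | right k => rw [← castAdd_add_halfTurn, hX, hY, h]

/-- By `⋆`-invariance the second half of the equations repeats the first. The `r`-th equation
involves the first unknown of the second half, which is `X_1^⋆`. -/
theorem sylvesterMap_unfold_eq_iff (s : StarOp) (A B C D E X : Fin r → Matrix (Fin n) (Fin n) ℂ) :
    sylvesterMap s (halfTurn r) (starProduct s A B C D).M (starProduct s A B C D).N (unfold s X) =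
      unfold s E ↔ IsSolution s A B C D E X := by
  have h1 : sylvesterMap s (halfTurn r) (starProduct s A B C D).M (starProduct s A B C D).N
      (unfold s X) = unfold s E ↔ ∀ k : Fin r,
      A k * X k * B k - C k * unfold s X (Fin.castAdd r k + 1) * D k = E k := by
    have h2 : ∀ k : Fin r, sylvesterMap s (halfTurn r) (starProduct s A B C D).M
        (starProduct s A B C D).N (unfold s X) (Fin.castAdd r k) =
        A k * X k * B k - C k * unfold s X (Fin.castAdd r k + 1) * D k := by
      intro k
      simp [sylvesterMap_apply, castAdd_add_halfTurn, starProduct, unfold,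
        -Fin.natAdd_eq_addNat]
    constructor
    · intro h k
      rw [← h2, h]; simp [unfold]
    · intro h
      refine eq_of_mem_starInvariant (sylvesterMap_mem halfTurn_add_halfTurn _ _ (unfold_mem s X))
        (unfold_mem s E) fun k => ?_
      rw [h2, h]; simp [unfold]
  rw [h1]
  constructor
  · intro h
    refine ⟨fun k hk => ?_, fun k hk => ?_⟩
    · simpa [castAdd_add_one_of_lt hk, unfold] using h k
    · simpa [castAdd_add_one_of_eq hk, unfold, -Fin.natAdd_eq_addNat] using h k
  · rintro ⟨h, h'⟩ k
    rcases (Nat.succ_le_of_lt k.isLt).lt_or_eq with hk | hk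
    · simpa [castAdd_add_one_of_lt hk, unfold] using h k hk
    · simpa [castAdd_add_one_of_eq hk, unfold, -Fin.natAdd_eq_addNat] using h' k hk

theorem isNonsingularSystem_iff (s : StarOp) (A B C D : Fin r → Matrix (Fin n) (Fin n) ℂ) :
    IsNonsingularSystem s A B C D ↔
      HasTrivialKernel s (halfTurn r) (starProduct s A B C D).M (starProduct s A B C D).N := by
  have hun : ∀ Y ∈ starInvariant s (halfTurn r) n,
      unfold s (fun k => Y (Fin.castAdd r k)) = Y := fun Y hY =>
    eq_of_mem_starInvariant (unfold_mem s _) hY fun k => by simp [unfold]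
  have hinj : ∀ X Y : Fin r → Matrix (Fin n) (Fin n) ℂ, unfold s X = unfold s Y → X = Y := by
    intro X Y h
    funext k
    simpa [unfold] using congrFun h (Fin.castAdd r k)
  constructor
  · intro h
    refine (hasTrivialKernel_iff_surjOn halfTurn_add_halfTurn _ _).2 fun E hE => ?_
    obtain ⟨X, hX, -⟩ := h fun k => E (Fin.castAdd r k)
    refine ⟨unfold s X, unfold_mem s X, ?_⟩
    rw [(sylvesterMap_unfold_eq_iff s A B C D _ X).2 hX, hun E hE]
  · intro h E
    obtain ⟨X, hX, e⟩ := (hasTrivialKernel_iff_surjOn halfTurn_add_halfTurn _ _).1 h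
      (unfold s E) (unfold_mem s E)
    refine ⟨fun k => X (Fin.castAdd r k), ?_, fun Y hY => ?_⟩
    · exact (sylvesterMap_unfold_eq_iff s A B C D E _).1 (by rw [hun X hX, e])
    · refine hinj _ _ ?_
      rw [hun X hX, ← sub_eq_zero]
      refine h _ (Submodule.sub_mem _ (unfold_mem s Y) hX) ?_
      rw [map_sub, (sylvesterMap_unfold_eq_iff s A B C D E Y).2 hY, e, sub_self]

theorem PeriodicSchurForm.hasTrivialKernel_iff {s : StarOp} {P : FormalProduct (r + r) n}
    (S : PeriodicSchurForm P) :
    HasTrivialKernel s (halfTurn r) P.M P.N ↔ HasTrivialKernel s (halfTurn r) S.T S.R := by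
  have hQ := fun k => Matrix.mem_unitaryGroup_iff.1 (S.Q_unitary k)
  have hQ' := fun k => Matrix.mem_unitaryGroup_iff'.1 (S.Q_unitary k)
  have hZ := fun k => Matrix.mem_unitaryGroup_iff.1 (S.Z_unitary k)
  have hZ' := fun k => Matrix.mem_unitaryGroup_iff'.1 (S.Z_unitary k)
  simp only [Matrix.star_eq_conjTranspose] at hQ hQ' hZ hZ'
  constructor
  · intro h
    have := h.of_equivalent halfTurn_add_halfTurn (U := fun k => (S.Q k)ᴴ) hQ hZ'
    have eT : S.T = fun k => (S.Q k)ᴴ * P.M k * S.Z k := funext fun k => (S.T_eq k).symm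
    have eR : S.R = fun k => (S.Q k)ᴴ * P.N k * S.Z (k + 1) :=
      funext fun k => by rw [← S.R_eq k, cyclicSucc_eq_add_one]
    rwa [eT, eR]
  · intro h
    have := h.of_equivalent halfTurn_add_halfTurn hQ' (V := fun k => (S.Z k)ᴴ) hZ
    have sandwich : ∀ {Q M Z : Matrix (Fin n) (Fin n) ℂ}, Q * Qᴴ = 1 → Z * Zᴴ = 1 →
        Q * (Qᴴ * M * Z) * Zᴴ = M := by
      intro Q M Z h1 h2
      calc Q * (Qᴴ * M * Z) * Zᴴ = (Q * Qᴴ) * M * (Z * Zᴴ) := by simp only [Matrix.mul_assoc]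
        _ = M := by rw [h1, h2, Matrix.one_mul, Matrix.mul_one]
    have eM : P.M = fun k => S.Q k * S.T k * (S.Z k)ᴴ := funext fun k => by
      rw [← S.T_eq, sandwich (hQ k) (hZ k)]
    have eN : P.N = fun k => S.Q k * S.R k * (S.Z (k + 1))ᴴ := funext fun k => by
      rw [← S.R_eq, cyclicSucc_eq_add_one, sandwich (hQ k) (hZ _)]
    rwa [eM, eN]

end Unfolding

/-! ### Triangular coefficients: reduction to scalar cyclic systems -/

section Triangular

variable {m n : ℕ} [NeZero m]

/-- The left-hand side of the scalar cyclic system `α_k y_k - β_k y_{k+1} = f_k`. -/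
def cyclicMap (α β : Fin m → ℂ) : (Fin m → ℂ) →ₗ[ℂ] (Fin m → ℂ) where
  toFun y k := α k * y k - β k * y (k + 1)
  map_add' x y := by ext k; simp only [Pi.add_apply]; ring
  map_smul' x y := by ext k; simp only [Pi.smul_apply, smul_eq_mul, RingHom.id_apply]; ring

@[simp] theorem cyclicMap_apply (α β y : Fin m → ℂ) (k : Fin m) :
    cyclicMap α β y k = α k * y k - β k * y (k + 1) := rfl

/-- The coefficients of the `(i, j)` entries of the unknowns in the `(i, j)` entry of a triangular
cyclic system. -/
def diagCoeff (s : StarOp) (c : Fin m) (T : Fin m → Matrix (Fin n) (Fin n) ℂ) (i j : Fin n)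
    (k : Fin m) : ℂ :=
  T k i i * s.conj (T (k + c) j j)

omit [NeZero m] in
-- Triangularity restricts the double sum to `Y a b` with `a ≥ i` and `b ≥ j`; of these, all but `Y
-- i j` have a larger index sum and vanish.
theorem mul_mul_app_apply (s : StarOp) {T T' Y : Matrix (Fin n) (Fin n) ℂ}
    (hT : ∀ i j, j < i → T i j = 0) (hT' : ∀ i j, j < i → T' i j = 0) {i j : Fin n}
    (hY : ∀ a b : Fin n, i.val + j.val < a.val + b.val → Y a b = 0) :
    (T * Y * s.app T') i j = T i i * s.conj (T' j j) * Y i j := by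
  rw [Matrix.mul_apply, Finset.sum_eq_single j, Matrix.mul_apply, Finset.sum_eq_single i,
    StarOp.app_apply]
  · ring
  · intro a _ ha
    rcases lt_or_gt_of_ne ha with h | h
    · rw [hT i a h, zero_mul]
    · rw [hY a j (by have := Fin.lt_def.1 h; omega), mul_zero]
  · simp
  · intro b _ hb
    rcases lt_or_gt_of_ne hb with h | h
    · rw [StarOp.app_apply, hT' j b h, map_zero, mul_zero]
    · rw [Matrix.mul_apply, Finset.sum_eq_zero, zero_mul]
      intro a _
      rcases lt_or_ge a i with h' | h'
      · rw [hT i a h', zero_mul]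
      · rw [hY a b (by have := Fin.lt_def.1 h; have := Fin.le_def.1 h'; omega), mul_zero]
  · simp

/-- The sequences that the entries `(i, j)` of `⋆`-invariant sequences of matrices form; only the
diagonal entries are subject to a condition. -/
def entryInvariant (s : StarOp) (c : Fin m) (i j : Fin n) : Submodule ℝ (Fin m → ℂ) where
  carrier := {y | i = j → ∀ k, y (k + c) = s.conj (y k)}
  add_mem' hx hy h k := by simp [hx h k, hy h k]
  zero_mem' _ k := by simp
  smul_mem' x y hy h k := by simp [hy h k]

/-- The scalar system for the entries `(i, j)` has only the zero solution. -/
def HasTrivialEntryKernel (s : StarOp) (c : Fin m) (T R : Fin m → Matrix (Fin n) (Fin n) ℂ)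
    (i j : Fin n) : Prop :=
  ∀ y ∈ entryInvariant s c i j, cyclicMap (diagCoeff s c T i j) (diagCoeff s c R i j) y = 0 → y = 0

variable {s : StarOp} {c : Fin m} {T R : Fin m → Matrix (Fin n) (Fin n) ℂ}

omit [NeZero m] in
theorem entry_mem_entryInvariant {Y : Fin m → Matrix (Fin n) (Fin n) ℂ}
    (hY : Y ∈ starInvariant s c n) (i j : Fin n) :
    (fun k => Y k i j) ∈ entryInvariant s c i j := by
  rintro rfl k
  simp [hY k]

theorem sylvesterMap_apply_apply (hT : ∀ k i j, j < i → T k i j = 0)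
    (hR : ∀ k i j, j < i → R k i j = 0) {Y : Fin m → Matrix (Fin n) (Fin n) ℂ} {i j : Fin n}
    (hY : ∀ k (a b : Fin n), i.val + j.val < a.val + b.val → Y k a b = 0) (k : Fin m) :
    sylvesterMap s c T R Y k i j =
      cyclicMap (diagCoeff s c T i j) (diagCoeff s c R i j) (fun k => Y k i j) k := by
  rw [sylvesterMap_apply, Matrix.sub_apply, mul_mul_app_apply s (hT k) (hT _) (hY k),
    mul_mul_app_apply s (hR k) (hR _) (hY _)]
  rfl

/-- Back substitution from the bottom right corner. The threshold `t` makes it usable when only the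
entries with large index sum are under control. -/
theorem entries_eq_zero (hT : ∀ k i j, j < i → T k i j = 0) (hR : ∀ k i j, j < i → R k i j = 0)
    {t : ℕ} (ht : ∀ i j : Fin n, t ≤ i.val + j.val → HasTrivialEntryKernel s c T R i j)
    {Y : Fin m → Matrix (Fin n) (Fin n) ℂ} (hY : Y ∈ starInvariant s c n)
    (hE : ∀ k (i j : Fin n), t ≤ i.val + j.val → sylvesterMap s c T R Y k i j = 0)
    (k : Fin m) (i j : Fin n) (hij : t ≤ i.val + j.val) : Y k i j = 0 := by
  induction hd : 2 * n - (i.val + j.val) using Nat.strong_induction_on generalizing k i j with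
  | _ d ih =>
    have hbig : ∀ k (a b : Fin n), i.val + j.val < a.val + b.val → Y k a b = 0 :=
      fun k a b hab => ih (2 * n - (a.val + b.val)) (by omega) k a b (by omega) rfl
    refine congrFun (ht i j hij _ (entry_mem_entryInvariant hY i j) (funext fun k => ?_)) k
    rw [← sylvesterMap_apply_apply hT hR hbig]
    exact hE k i j hij

theorem hasTrivialEntryKernel_of_surjOn (hc : c + c = 0) {i j : Fin n}
    (h : ∀ f ∈ entryInvariant s c i j, ∃ y ∈ entryInvariant s c i j,
      cyclicMap (diagCoeff s c T i j) (diagCoeff s c R i j) y = f) :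
    HasTrivialEntryKernel s c T R i j := by
  have hmem : ∀ y ∈ entryInvariant s c i j,
      (cyclicMap (diagCoeff s c T i j) (diagCoeff s c R i j)).restrictScalars ℝ y ∈
        entryInvariant s c i j := by
    rintro y hy rfl k
    have h2 : k + c + c = k := by rw [add_assoc, hc, add_zero]
    have h1 : y (k + c + 1) = s.conj (y (k + 1)) := by rw [add_right_comm]; exact hy rfl _
    simp only [LinearMap.coe_restrictScalars, cyclicMap_apply, diagCoeff, h2, h1, hy rfl k, map_sub,
      map_mul, StarOp.conj_conj]
    ring
  let f := ((cyclicMap (diagCoeff s c T i j) (diagCoeff s c R i j)).restrictScalars ℝ).restrict hmem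
  have hf : Function.Injective f := by
    refine LinearMap.injective_iff_surjective.2 ?_
    rintro ⟨g, hg⟩
    obtain ⟨y, hy, e⟩ := h g hg
    exact ⟨⟨y, hy⟩, Subtype.ext e⟩
  intro y hy h0
  have : (⟨y, hy⟩ : entryInvariant s c i j) = 0 := hf (by rw [map_zero]; exact Subtype.ext h0)
  exact congrArg Subtype.val this

/-- From matrices to entries, a scalar kernel vector need not extend to a matrix kernel vector, so
surjectivity is transported instead: solve for a right-hand side supported at `(i, j)` and its
mirror. By induction all entries with larger index sum vanish, so the `(i, j)` entries of the
solution solve the scalar system. -/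
theorem hasTrivialKernel_iff_entries (hc : c + c = 0) (hT : ∀ k i j, j < i → T k i j = 0)
    (hR : ∀ k i j, j < i → R k i j = 0) :
    HasTrivialKernel s c T R ↔ ∀ i j, HasTrivialEntryKernel s c T R i j := by
  constructor
  · intro h i j
    induction hd : 2 * n - (i.val + j.val) using Nat.strong_induction_on generalizing i j with
    | _ d ih =>
      refine hasTrivialEntryKernel_of_surjOn hc fun f hf => ?_
      -- The `(j, i)` entry is forced by `⋆`-invariance; for `i = j` the two prescriptions agree
      -- because `f ∈ entryInvariant s c i i`.
      let E : Fin m → Matrix (Fin n) (Fin n) ℂ := fun k => Matrix.of fun a b =>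
        if a = i ∧ b = j then f k else if a = j ∧ b = i then s.conj (f (k + c)) else 0
      have hE : E ∈ starInvariant s c n := by
        intro k
        have h2 : k + c + c = k := by rw [add_assoc, hc, add_zero]
        ext a b
        simp only [E, Matrix.of_apply, StarOp.app_apply, h2]
        by_cases h1 : a = i ∧ b = j
        · obtain ⟨rfl, rfl⟩ := h1
          by_cases hab : a = b
          · simpa [hab] using hf hab k
          · simp [hab, Ne.symm hab]
        · by_cases h3 : a = j ∧ b = i
          · have hne : ¬ (j = i ∧ i = j) := fun h => h1 ⟨h3.1.trans h.1, h3.2.trans h.2⟩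
            simp [h3, hne]
          · simp [h1, h3, and_comm]
      obtain ⟨Y, hY, e⟩ := (hasTrivialKernel_iff_surjOn hc _ _).1 h E hE
      have hbig : ∀ k (a b : Fin n), i.val + j.val < a.val + b.val → Y k a b = 0 := by
        refine entries_eq_zero hT hR (fun a b hab => ih (2 * n - (a.val + b.val)) (by omega) a b rfl)
          hY fun k a b hab => ?_
        have h1 : ¬ (a = i ∧ b = j) := by rintro ⟨rfl, rfl⟩; omega
        have h2 : ¬ (a = j ∧ b = i) := by rintro ⟨rfl, rfl⟩; omega
        simp [e, E, h1, h2]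
      refine ⟨fun k => Y k i j, entry_mem_entryInvariant hY i j, funext fun k => ?_⟩
      rw [← sylvesterMap_apply_apply hT hR hbig, e]
      simp [E]
  · intro h Y hY h0
    funext k
    ext i j
    exact entries_eq_zero hT hR (fun i j _ => h i j) hY (fun k i j _ => by simp [h0]) k i j
      (Nat.zero_le _)

end Triangular

/-! ### Scalar cyclic systems -/

section Cyclic

theorem cyclicMap_rotate {m : ℕ} [NeZero m] {α β y : Fin m → ℂ} (c : Fin m)
    (h : cyclicMap α β y = 0) :
    cyclicMap (fun k => α (k + c)) (fun k => β (k + c)) (fun k => y (k + c)) = 0 := by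
  funext k
  have := congrFun h (k + c)
  simpa [add_right_comm k 1 c] using this

theorem prod_rotate {m : ℕ} [NeZero m] (α : Fin m → ℂ) (c : Fin m) :
    ∏ k, α (k + c) = ∏ k, α k :=
  Fintype.prod_equiv (Equiv.addRight c) _ _ fun _ => rfl

theorem prod_Iio_succ {q : ℕ} (f : Fin (q + 1) → ℂ) (i : Fin q) :
    ∏ k ∈ Finset.Iio i.succ, f k = f i.castSucc * ∏ k ∈ Finset.Iio i.castSucc, f k := by
  rw [← Finset.prod_insert (by simp)]
  congr 1
  ext x
  simp only [Finset.mem_Iio, Finset.mem_insert, Fin.lt_def, Fin.ext_iff, Fin.val_succ,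
    Fin.val_castSucc]
  omega

theorem prod_eq_mul_prod_Iio_last {q : ℕ} (f : Fin (q + 1) → ℂ) :
    ∏ k, f k = f (Fin.last q) * ∏ k ∈ Finset.Iio (Fin.last q), f k := by
  rw [← Finset.prod_insert (by simp)]
  congr 1
  ext x
  simp only [Finset.mem_univ, Finset.mem_insert, Finset.mem_Iio, true_iff]
  exact (Fin.le_last x).eq_or_lt

theorem prod_mul_zero_of_cyclicMap_eq_zero {q : ℕ} {α β y : Fin (q + 1) → ℂ}
    (h : cyclicMap α β y = 0) : (∏ k, α k) * y 0 = (∏ k, β k) * y 0 := by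
  have step : ∀ k, α k * y k = β k * y (k + 1) := fun k => sub_eq_zero.1 (congrFun h k)
  have key : ∀ i : Fin (q + 1), (∏ k ∈ Finset.Iio i, α k) * y 0 = (∏ k ∈ Finset.Iio i, β k) * y i := by
    intro i
    induction i using Fin.induction with
    | zero => simp [← bot_eq_zero]
    | succ i ih =>
      rw [prod_Iio_succ, prod_Iio_succ, mul_assoc, ih, mul_left_comm, step, Fin.coeSucc_eq_succ]
      ring
  rw [prod_eq_mul_prod_Iio_last, prod_eq_mul_prod_Iio_last β, mul_assoc, key, mul_left_comm, step,
    Fin.last_add_one]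
  ring

/-- Without the wrap-around coefficient the matrix of the system is upper bidiagonal with diagonal
`α`, so its determinant is `∏ k, α k`. -/
theorem exists_cyclicMap_eq_zero_of_last_eq_zero {q : ℕ} {α β : Fin (q + 1) → ℂ}
    (hβ : β (Fin.last q) = 0) (hα : ∏ k, α k = 0) : ∃ y ≠ 0, cyclicMap α β y = 0 := by
  let L : Matrix (Fin (q + 1)) (Fin (q + 1)) ℂ := LinearMap.toMatrix' (cyclicMap α β)
  have hL : ∀ i j, L i j = α i * (if i = j then 1 else 0) - β i * (if i + 1 = j then 1 else 0) := by
    intro i j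
    simp [L, LinearMap.toMatrix'_apply, Pi.single_apply]
  have htri : L.BlockTriangular id := by
    intro i j hij
    have hij : j < i := hij
    rw [hL, if_neg hij.ne']
    induction i using Fin.lastCases with
    | last => simp [hβ]
    | cast i =>
      rw [Fin.coeSucc_eq_succ, if_neg (hij.trans (Fin.castSucc_lt_succ)).ne']
      simp
  have hdet : L.det = 0 := by
    rw [Matrix.det_of_isUpperTriangular htri, ← hα]
    refine Finset.prod_congr rfl fun i _ => ?_
    rw [hL]
    induction i using Fin.lastCases with
    | last => simp [hβ]
    | cast i => simp [Fin.coeSucc_eq_succ, (Fin.castSucc_lt_succ (i := i)).ne']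
  obtain ⟨y, hy, h0⟩ := Matrix.exists_mulVec_eq_zero_iff.2 hdet
  refine ⟨y, hy, ?_⟩
  rwa [LinearMap.toMatrix'_mulVec] at h0

theorem exists_cyclicMap_eq_zero {q : ℕ} {α β : Fin (q + 1) → ℂ} (h : ∏ k, α k = ∏ k, β k) :
    ∃ y ≠ 0, cyclicMap α β y = 0 := by
  by_cases hβ : ∃ l, β l = 0
  · obtain ⟨l, hl⟩ := hβ
    obtain ⟨y, hy, h0⟩ := exists_cyclicMap_eq_zero_of_last_eq_zero
      (α := fun k => α (k + (l - Fin.last q))) (β := fun k => β (k + (l - Fin.last q)))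
      (by simpa using hl) (by rw [prod_rotate, h]; exact Finset.prod_eq_zero (Finset.mem_univ l) hl)
    refine ⟨fun k => y (k + -(l - Fin.last q)), fun h => hy (funext fun k => ?_), ?_⟩
    · simpa only [add_neg_cancel_right, Pi.zero_apply] using congrFun h (k + (l - Fin.last q))
    · simpa only [neg_add_cancel_right] using cyclicMap_rotate (-(l - Fin.last q)) h0
  · push Not at hβ
    -- This solves the recursion from `y 0 = 1`; it closes up because the product of all ratios is
    -- `1`.
    refine ⟨fun i => ∏ k ∈ Finset.Iio i, (α k / β k), fun h0 => ?_, funext fun i => ?_⟩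
    · simpa [← bot_eq_zero] using congrFun h0 0
    · have hi := hβ i
      simp only [cyclicMap_apply, Pi.zero_apply, sub_eq_zero]
      have e : ∏ k ∈ Finset.Iio (i + 1), (α k / β k) =
          α i / β i * ∏ k ∈ Finset.Iio i, (α k / β k) := by
        induction i using Fin.lastCases with
        | last =>
          have e : ∏ k, α k / β k = 1 := by
            rw [Finset.prod_div_distrib, h,
              div_self (Finset.prod_ne_zero_iff.2 fun k _ => hβ k)]
          rw [← prod_eq_mul_prod_Iio_last (fun k => α k / β k), e, Fin.last_add_one]
          simp [← bot_eq_zero]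
        | cast i => rw [Fin.coeSucc_eq_succ, prod_Iio_succ]
      rw [e]
      field_simp

/-- Chaining the equations once around gives `(∏ α) y_0 = (∏ β) y_0`; rotation gives the same at
every index. -/
theorem cyclicMap_injective_iff {m : ℕ} [NeZero m] (α β : Fin m → ℂ) :
    (∀ y, cyclicMap α β y = 0 → y = 0) ↔ ∏ k, α k ≠ ∏ k, β k := by
  obtain ⟨q, rfl⟩ := Nat.exists_eq_succ_of_ne_zero (NeZero.ne m)
  constructor
  · intro h e
    obtain ⟨y, hy, h0⟩ := exists_cyclicMap_eq_zero e
    exact hy (h y h0)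
  · intro h y h0
    funext k
    have := prod_mul_zero_of_cyclicMap_eq_zero (cyclicMap_rotate k h0)
    rw [prod_rotate, prod_rotate, zero_add] at this
    by_contra hk
    exact h (mul_right_cancel₀ hk this)

end Cyclic

/-! ### Kernel conditions for single entries -/

section Entries

variable {m n : ℕ} [NeZero m] {s : StarOp} {c : Fin m} {T R : Fin m → Matrix (Fin n) (Fin n) ℂ}

theorem prod_diagCoeff (i j : Fin n) :
    ∏ k, diagCoeff s c T i j k = (∏ k, T k i i) * s.conj (∏ k, T k j j) := by
  simp only [diagCoeff, Finset.prod_mul_distrib, map_prod]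
  rw [prod_rotate (fun k => s.conj (T k j j)) c]

theorem hasTrivialEntryKernel_of_prod_ne {i j : Fin n}
    (h : (∏ k, T k i i) * s.conj (∏ k, T k j j) ≠ (∏ k, R k i i) * s.conj (∏ k, R k j j)) :
    HasTrivialEntryKernel s c T R i j := by
  rw [← prod_diagCoeff (c := c), ← prod_diagCoeff (c := c)] at h
  exact fun y _ => (cyclicMap_injective_iff _ _).2 h y

theorem hasTrivialEntryKernel_iff_of_ne {i j : Fin n} (hij : i ≠ j) :
    HasTrivialEntryKernel s c T R i j ↔
      (∏ k, T k i i) * s.conj (∏ k, T k j j) ≠ (∏ k, R k i i) * s.conj (∏ k, R k j j) := by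
  refine ⟨fun h => ?_, hasTrivialEntryKernel_of_prod_ne⟩
  rw [← prod_diagCoeff (c := c), ← prod_diagCoeff (c := c), ← cyclicMap_injective_iff]
  exact fun y => h y fun e => (hij e).elim

theorem cyclicMap_conj_rotate_eq_zero (hc : c + c = 0) {i : Fin n} {y : Fin m → ℂ}
    (h : cyclicMap (diagCoeff s c T i i) (diagCoeff s c R i i) y = 0) :
    cyclicMap (diagCoeff s c T i i) (diagCoeff s c R i i) (fun k => s.conj (y (k + c))) = 0 := by
  funext k
  have h2 : k + c + c = k := by rw [add_assoc, hc, add_zero]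
  have := congrArg s.conj (congrFun h (k + c))
  simp only [cyclicMap_apply, diagCoeff, h2, map_sub, map_mul, StarOp.conj_conj, Pi.zero_apply,
    map_zero] at this ⊢
  rw [add_right_comm k 1 c, ← this]
  ring

theorem hasTrivialEntryKernel_conjTranspose_iff (hc : c + c = 0) (i j : Fin n) :
    HasTrivialEntryKernel .conjTranspose c T R i j ↔
      (∏ k, T k i i) * starRingEnd ℂ (∏ k, T k j j) ≠
        (∏ k, R k i i) * starRingEnd ℂ (∏ k, R k j j) := by
  by_cases hij : i = j
  swap
  · exact hasTrivialEntryKernel_iff_of_ne hij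
  subst hij
  refine ⟨fun h => ?_, hasTrivialEntryKernel_of_prod_ne (s := .conjTranspose)⟩
  change _ * StarOp.conjTranspose.conj _ ≠ _ * StarOp.conjTranspose.conj _
  rw [← prod_diagCoeff (c := c), ← prod_diagCoeff (c := c), ← cyclicMap_injective_iff]
  -- The kernel is stable under the conjugate-linear involution `y ↦ conj (y (· + c))`, whose fixed
  -- points are the invariant sequences. Thus `y` plus its image is an invariant kernel element,
  -- hence zero; the same for `I • y` kills the difference.
  have key : ∀ y, cyclicMap (diagCoeff .conjTranspose c T i i) (diagCoeff .conjTranspose c R i i) y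
      = 0 → ∀ k, y k + starRingEnd ℂ (y (k + c)) = 0 := by
    intro y hy
    refine congrFun (h (fun k => y k + starRingEnd ℂ (y (k + c))) (fun _ k => ?_) ?_)
    · have h2 : k + c + c = k := by rw [add_assoc, hc, add_zero]
      simp [h2, StarOp.conj, add_comm (y k)]
    · change cyclicMap _ _ (y + fun k => StarOp.conjTranspose.conj (y (k + c))) = 0
      rw [map_add, hy, cyclicMap_conj_rotate_eq_zero hc hy, add_zero]
  intro y hy
  funext k
  have h1 := key y hy k
  have h2 := key (Complex.I • y) (by rw [map_smul, hy, smul_zero]) k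
  simp only [Pi.smul_apply, smul_eq_mul, map_mul, Complex.conj_I] at h2
  have h3 : y k - starRingEnd ℂ (y (k + c)) = 0 :=
    mul_left_cancel₀ Complex.I_ne_zero (by linear_combination h2)
  simpa using (by linear_combination (h1 + h3) / 2 : y k = 0)

end Entries

theorem apply_castAdd_add_one {r : ℕ} [NeZero r] {y : Fin (r + r) → ℂ}
    (hy : ∀ k, y (k + halfTurn r) = y k) (k : Fin r) :
    y (Fin.castAdd r k + 1) = y (Fin.castAdd r (k + 1)) := by
  rw [← cyclicSucc_eq_add_one k]
  rcases (Nat.succ_le_of_lt k.isLt).lt_or_eq with hk | hk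
  · rw [castAdd_add_one_of_lt hk]
  · rw [castAdd_add_one_of_eq hk, ← castAdd_add_halfTurn, hy]

/-- Here invariance means periodicity with period `r`, and the coefficients `(T_k)_{ii}
(T_{k+r})_{ii}` have this period too. The system is therefore a cyclic one of length `r`, whose
coefficient products run over each of the `2r` diagonal entries once, not twice. -/
theorem hasTrivialEntryKernel_transpose_self_iff {r n : ℕ} [NeZero r]
    {T R : Fin (r + r) → Matrix (Fin n) (Fin n) ℂ} (i : Fin n) :
    HasTrivialEntryKernel .transpose (halfTurn r) T R i i ↔ ∏ k, T k i i ≠ ∏ k, R k i i := by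
  have hprod : ∀ T : Fin (r + r) → Matrix (Fin n) (Fin n) ℂ, ∏ k, T k i i =
      ∏ k : Fin r, diagCoeff .transpose (halfTurn r) T i i (Fin.castAdd r k) := by
    intro T
    rw [Fin.prod_univ_add, ← Finset.prod_mul_distrib]
    simp only [diagCoeff, castAdd_add_halfTurn, StarOp.conj, RingHom.id_apply]
  rw [hprod, hprod, ← cyclicMap_injective_iff]
  have hcyc : ∀ y : Fin (r + r) → ℂ, (∀ k, y (k + halfTurn r) = y k) → ∀ k : Fin r,
      cyclicMap (diagCoeff .transpose (halfTurn r) T i i)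
        (diagCoeff .transpose (halfTurn r) R i i) y (Fin.castAdd r k) =
      cyclicMap (fun k => diagCoeff .transpose (halfTurn r) T i i (Fin.castAdd r k))
        (fun k => diagCoeff .transpose (halfTurn r) R i i (Fin.castAdd r k))
        (fun k => y (Fin.castAdd r k)) k := by
    intro y hy k
    simp only [cyclicMap_apply, apply_castAdd_add_one hy]
  constructor
  · intro h z hz
    have hy : ∀ k, Fin.append z z (k + halfTurn r) = Fin.append z z k := by
      intro k
      induction k using Fin.addCases with
      | left k => rw [castAdd_add_halfTurn, Fin.append_left, Fin.append_right]
      | right k => rw [natAdd_add_halfTurn, Fin.append_left, Fin.append_right]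
    have h0 : ∀ k : Fin r, cyclicMap (diagCoeff .transpose (halfTurn r) T i i)
        (diagCoeff .transpose (halfTurn r) R i i) (Fin.append z z) (Fin.castAdd r k) = 0 := by
      intro k
      rw [hcyc _ hy]
      simp only [Fin.append_left]
      exact congrFun hz k
    have := h (Fin.append z z) (fun _ => hy) (funext fun k => by
      induction k using Fin.addCases with
      | left k => exact h0 k
      | right k =>
        rw [Pi.zero_apply, ← h0 k, ← castAdd_add_halfTurn]
        simp only [cyclicMap_apply, diagCoeff, add_right_comm _ (halfTurn r) 1, hy, StarOp.conj,
          RingHom.id_apply]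
        rw [add_assoc, halfTurn_add_halfTurn, add_zero]
        ring)
    funext k
    simpa only [Fin.append_left, Pi.zero_apply] using congrFun this (Fin.castAdd r k)
  · intro h y hy h0
    have hy : ∀ k, y (k + halfTurn r) = y k := hy rfl
    have hz := h (fun k => y (Fin.castAdd r k)) (funext fun k => by rw [← hcyc y hy, h0]; rfl)
    funext k
    induction k using Fin.addCases with
    | left k => exact congrFun hz k
    | right k => rw [← castAdd_add_halfTurn, hy]; exact congrFun hz k

/-! ### Eigenvalues in homogeneous coordinates and the spectral criteria -/

section Fractions

open Classical in
/-- The element `t / ρ` of `ℂ ∪ {∞}`, with `t / 0 = ∞`. -/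
def projDiv (t ρ : ℂ) : OnePoint ℂ :=
  if ρ = 0 then OnePoint.infty else ((t / ρ : ℂ) : OnePoint ℂ)

variable {t ρ t' ρ' : ℂ}

theorem recip_infty : recip OnePoint.infty = ((0 : ℂ) : OnePoint ℂ) := rfl

theorem recip_zero : recip ((0 : ℂ) : OnePoint ℂ) = OnePoint.infty := by
  change (if (0 : ℂ) = 0 then _ else _) = _
  rw [if_pos rfl]

theorem recip_coe {z : ℂ} (h : z ≠ 0) : recip (z : OnePoint ℂ) = ((z⁻¹ : ℂ) : OnePoint ℂ) := by
  change (if z = 0 then _ else _) = _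
  rw [if_neg h]

theorem recip_projDiv (h : ¬ (t = 0 ∧ ρ = 0)) : recip (projDiv t ρ) = projDiv ρ t := by
  by_cases hρ : ρ = 0
  · have ht : t ≠ 0 := fun ht => h ⟨ht, hρ⟩
    simp [projDiv, hρ, ht, recip_infty]
  · by_cases ht : t = 0
    · simp [projDiv, hρ, ht, recip_zero]
    · simp [projDiv, hρ, ht, recip_coe (div_ne_zero ht hρ)]

/-- Cross-multiplication on the projective line; only the pair `(0, 0)`, the singular case, has to
be excluded. -/
theorem projDiv_eq_projDiv_iff (h : ¬ (t = 0 ∧ ρ = 0)) (h' : ¬ (t' = 0 ∧ ρ' = 0)) :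
    projDiv t ρ = projDiv t' ρ' ↔ t * ρ' = ρ * t' := by
  by_cases hρ : ρ = 0 <;> by_cases hρ' : ρ' = 0
  · simp [projDiv, hρ, hρ']
  · have ht : t ≠ 0 := fun ht => h ⟨ht, hρ⟩
    simp [projDiv, hρ, hρ', ht]
  · have ht' : t' ≠ 0 := fun ht' => h' ⟨ht', hρ'⟩
    simp [projDiv, hρ, hρ', ht']
  · simp only [projDiv, hρ, hρ', if_false, OnePoint.coe_eq_coe]
    rw [div_eq_div_iff hρ hρ', mul_comm t' ρ]

theorem projDiv_eq_recip_iff (h : ¬ (t = 0 ∧ ρ = 0)) (h' : ¬ (t' = 0 ∧ ρ' = 0)) :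
    projDiv t ρ = recip (projDiv t' ρ') ↔ t * t' = ρ * ρ' := by
  rw [recip_projDiv h', projDiv_eq_projDiv_iff h fun e => h' e.symm]

theorem projDiv_eq_neg_one_iff (h : ¬ (t = 0 ∧ ρ = 0)) :
    projDiv t ρ = ((-1 : ℂ) : OnePoint ℂ) ↔ t = -ρ := by
  have e : ((-1 : ℂ) : OnePoint ℂ) = projDiv (-1) 1 := by simp [projDiv]
  rw [e, projDiv_eq_projDiv_iff h (by simp)]
  simp

theorem conjugate_projDiv (t ρ : ℂ) :
    conjugate (projDiv t ρ) = projDiv (starRingEnd ℂ t) (starRingEnd ℂ ρ) := by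
  by_cases hρ : ρ = 0
  · simp [projDiv, hρ, conjugate]
  · simp [projDiv, hρ, conjugate]

variable {ι : Type*} {t ρ : ι → ℂ}

theorem isHReciprocalFree_range_iff (h : ∀ i, ¬ (t i = 0 ∧ ρ i = 0)) :
    IsHReciprocalFree (Set.range fun i => projDiv (t i) (ρ i)) ↔
      ∀ i j, t i * starRingEnd ℂ (t j) ≠ ρ i * starRingEnd ℂ (ρ j) := by
  have h' : ∀ j, ¬ (starRingEnd ℂ (t j) = 0 ∧ starRingEnd ℂ (ρ j) = 0) := by simpa using h
  simp only [IsHReciprocalFree, Set.forall_mem_range, conjugate_projDiv, Ne,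
    projDiv_eq_recip_iff (h _) (h' _)]

theorem isReciprocalFree_range_diff_iff (h : ∀ i, ¬ (t i = 0 ∧ ρ i = 0)) :
    IsReciprocalFree ((Set.range fun i => projDiv (t i) (ρ i)) \ {((-1 : ℂ) : OnePoint ℂ)}) ↔
      ∀ i j, t i ≠ -ρ i → t j ≠ -ρ j → t i * t j ≠ ρ i * ρ j := by
  constructor
  · intro H i j hi hj e
    refine H _ ⟨⟨i, rfl⟩, ?_⟩ _ ⟨⟨j, rfl⟩, ?_⟩ ((projDiv_eq_recip_iff (h i) (h j)).2 e)
    · exact fun e => hi ((projDiv_eq_neg_one_iff (h i)).1 e)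
    · exact fun e => hj ((projDiv_eq_neg_one_iff (h j)).1 e)
  · rintro H _ ⟨⟨i, rfl⟩, hi⟩ _ ⟨⟨j, rfl⟩, hj⟩ e
    refine H i j (fun e => hi ?_) (fun e => hj ?_) ((projDiv_eq_recip_iff (h i) (h j)).1 e)
    · exact (projDiv_eq_neg_one_iff (h i)).2 e
    · exact (projDiv_eq_neg_one_iff (h j)).2 e

end Fractions

section Criterion

theorem isHReciprocalFree_criterion {ι : Type*} (t ρ : ι → ℂ) :
    (∀ i j, t i * starRingEnd ℂ (t j) ≠ ρ i * starRingEnd ℂ (ρ j)) ↔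
      (∀ i, ¬ (t i = 0 ∧ ρ i = 0)) ∧
        IsHReciprocalFree (Set.range fun i => projDiv (t i) (ρ i)) := by
  constructor
  · intro H
    have h : ∀ i, ¬ (t i = 0 ∧ ρ i = 0) := fun i hi => H i i (by simp [hi.1, hi.2])
    exact ⟨h, (isHReciprocalFree_range_iff h).2 H⟩
  · rintro ⟨h, H⟩
    exact (isHReciprocalFree_range_iff h).1 H

/-- The self-reciprocal values are `1` and `-1`. The value `1` is excluded by `t i ≠ ρ i`; the value
`-1` passes this test, but two occurrences would violate the condition for `i ≠ j`. -/
theorem isReciprocalFree_criterion {ι : Type*} [Finite ι] (t ρ : ι → ℂ) :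
    (∀ i j, i ≠ j → t i * t j ≠ ρ i * ρ j) ∧ (∀ i, t i ≠ ρ i) ↔
      (∀ i, ¬ (t i = 0 ∧ ρ i = 0)) ∧
        IsReciprocalFree
          ((Set.range fun i => projDiv (t i) (ρ i)) \ {((-1 : ℂ) : OnePoint ℂ)}) ∧
        {i | projDiv (t i) (ρ i) = ((-1 : ℂ) : OnePoint ℂ)}.ncard ≤ 1 := by
  constructor
  · rintro ⟨H, H'⟩
    have h : ∀ i, ¬ (t i = 0 ∧ ρ i = 0) := fun i hi => H' i (hi.1.trans hi.2.symm)
    refine ⟨h, (isReciprocalFree_range_diff_iff h).2 fun i j hi hj e => ?_, ?_⟩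
    · by_cases hij : i = j
      · subst hij
        rcases mul_self_eq_mul_self_iff.1 e with e | e
        · exact H' i e
        · exact hi e
      · exact H i j hij e
    · rw [Set.ncard_le_one (Set.toFinite _)]
      intro i hi j hj
      by_contra hij
      have hi := (projDiv_eq_neg_one_iff (h i)).1 hi
      have hj := (projDiv_eq_neg_one_iff (h j)).1 hj
      exact H i j hij (by rw [hi, hj, neg_mul_neg])
  · rintro ⟨h, H, hm⟩
    rw [isReciprocalFree_range_diff_iff h] at H
    rw [Set.ncard_le_one (Set.toFinite _)] at hm
    -- The only reciprocal partner of `-1` is `-1`, so a violating pair has either both eigenvalues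
    -- equal to `-1` or neither.
    have neg_of_neg : ∀ i j, t i * t j = ρ i * ρ j → t i = -ρ i → t j = -ρ j := by
      intro i j e hi
      have hρ : ρ i ≠ 0 := fun h0 => h i ⟨by rw [hi, h0, neg_zero], h0⟩
      rw [hi] at e
      exact mul_left_cancel₀ hρ (by linear_combination -e)
    constructor
    · intro i j hij e
      by_cases hi : t i = -ρ i
      · exact hij (hm i ((projDiv_eq_neg_one_iff (h i)).2 hi) j
          ((projDiv_eq_neg_one_iff (h j)).2 (neg_of_neg i j e hi)))
      · exact H i j hi (fun hj => hi (neg_of_neg j i (by rw [mul_comm, e, mul_comm]) hj)) e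
    · intro i e
      have hi : t i ≠ -ρ i := by
        intro e'
        have : ρ i = 0 := self_eq_neg.1 (e.symm.trans e')
        exact h i ⟨e.trans this, this⟩
      exact H i i hi hi (by rw [e])

end Criterion

theorem isNonsingularSystem_iff_entries {r n : ℕ} [NeZero r] {s : StarOp}
    {A B C D : Fin r → Matrix (Fin n) (Fin n) ℂ}
    (S : PeriodicSchurForm (starProduct s A B C D)) :
    IsNonsingularSystem s A B C D ↔
      ∀ i j, HasTrivialEntryKernel s (halfTurn r) S.T S.R i j := by
  rw [isNonsingularSystem_iff, S.hasTrivialKernel_iff,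
    hasTrivialKernel_iff_entries halfTurn_add_halfTurn S.T_upper S.R_upper]

end PeriodicSylvester

end

theorem theorem4p2 (r n : ℕ) (hr : 0 < r) (s : PeriodicSylvester.StarOp)
    (A B C D : Fin r → Matrix (Fin n) (Fin n) ℂ) :
    Nonempty (PeriodicSylvester.PeriodicSchurForm (PeriodicSylvester.starProduct s A B C D)) ∧
    ∀ S : PeriodicSylvester.PeriodicSchurForm (PeriodicSylvester.starProduct s A B C D),
      PeriodicSylvester.IsNonsingularSystem s A B C D ↔
        S.IsRegular ∧
        (s = PeriodicSylvester.StarOp.conjTranspose →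
          PeriodicSylvester.IsHReciprocalFree S.spectrum) ∧
        (s = PeriodicSylvester.StarOp.transpose →
          PeriodicSylvester.IsReciprocalFree (S.spectrum \ {((-1 : ℂ) : OnePoint ℂ)}) ∧
          S.multiplicity ((-1 : ℂ) : OnePoint ℂ) ≤ 1) := by
  refine ⟨PeriodicSylvester.nonempty_periodicSchurForm _, fun S => ?_⟩
  have : NeZero r := ⟨hr.ne'⟩
  rw [PeriodicSylvester.isNonsingularSystem_iff_entries S]
  cases s with
  | conjTranspose =>
    simp only [PeriodicSylvester.hasTrivialEntryKernel_conjTranspose_iff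
      PeriodicSylvester.halfTurn_add_halfTurn, true_imp_iff, reduceCtorEq, false_imp_iff, and_true]
    -- `eigenvalue` unfolds to `projDiv` of the two diagonal products.
    exact PeriodicSylvester.isHReciprocalFree_criterion _ _
  | transpose =>
    simp only [true_imp_iff, reduceCtorEq, false_imp_iff, true_and]
    refine Iff.trans ?_ (PeriodicSylvester.isReciprocalFree_criterion
      (fun i => ∏ k, S.T k i i) (fun i => ∏ k, S.R k i i))
    constructor
    · intro h
      exact ⟨fun i j hij => (PeriodicSylvester.hasTrivialEntryKernel_iff_of_ne hij).1 (h i j),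
        fun i => (PeriodicSylvester.hasTrivialEntryKernel_transpose_self_iff i).1 (h i i)⟩
    · rintro ⟨h, h'⟩ i j
      by_cases hij : i = j
      · subst hij
        exact (PeriodicSylvester.hasTrivialEntryKernel_transpose_self_iff i).2 (h' i)
      · exact (PeriodicSylvester.hasTrivialEntryKernel_iff_of_ne hij).2 (h i j hij)
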